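/- Let $R$ be an integral domain with quotient field $K$. An overring of $R$ is a ring $T$ with $R\subseteq T\subseteq K$; it is called an intersection of localizations of $R$ if $T=\bigcap_{P\in\mathcal P}R_P$ for some set $\mathcal P$ of prime ideals of $R$ (the empty intersection being $K$). Call $R$ an sQQR-domain if every simple overring $R[u]$, $u\in K$, is an intersection of localizations of $R$, and a QQR-domain if every overring of $R$ is an intersection of localizations of $R$. **Theorem.** Suppose that $R$ is semilocal (that is, $R$ has only finitely many maximal ideals) and that $\operatorname{Spec}(R)$ is treed (that is, the prime ideals of $R$ contained in any given prime ideal form a chain under inclusion). If $R$ is an sQQR-domain, then $R$ is a QQR-domain. -/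

import Mathlib

section QQR

variable (R K : Type*) [CommRing R] [IsDomain R] [Field K] [Algebra R K] [IsFractionRing R K]

/-- The localization `R_P` of the domain `R` at the prime `P`, as a subring of the quotient field
`K`: the set of all fractions `a / s` with `a s : R` and `s ∉ P`. -/
noncomputable def localizationAt (P : PrimeSpectrum R) : Subalgebra R K :=
  Localization.subalgebra.ofField K P.asIdeal.primeCompl P.asIdeal.primeCompl_le_nonZeroDivisors

/-- An overring `T` of `R` (a ring with `R ⊆ T ⊆ K`, i.e. an `R`-subalgebra of `K`) is an
intersection of localizations of `R`: there is a set `S` of primes of `R` such that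
`T = ⋂ P ∈ S, R_P`. The empty intersection is `K`, which is also the localization at `0`. -/
def IsIntersectionOfLocalizations (T : Subalgebra R K) : Prop :=
  ∃ S : Set (PrimeSpectrum R), T = ⨅ P ∈ S, localizationAt R K P

/-- `R` is an sQQR-domain: every simple overring `R[u]`, with `u` in the quotient field `K`,
is an intersection of localizations of `R`. -/
def IsSQQRDomain : Prop :=
  ∀ u : K, IsIntersectionOfLocalizations R K (Algebra.adjoin R {u})

/-- `R` is a QQR-domain: every overring of `R` in the quotient field `K` is an intersection of
localizations of `R`. -/
def IsQQRDomain : Prop :=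
  ∀ T : Subalgebra R K, IsIntersectionOfLocalizations R K T

end QQR

/-- `R` is semilocal: it has only finitely many maximal ideals. -/
def IsSemilocal (R : Type*) [CommRing R] : Prop :=
  Finite (MaximalSpectrum R)

/-- The prime spectrum of `R`, ordered by inclusion, is treed: the primes contained in any given
prime form a chain. -/
def HasTreedSpectrum (R : Type*) [CommRing R] : Prop :=
  ∀ N : PrimeSpectrum R, IsChain (· ≤ ·) (Set.Iic N)

section DenominatorIdeal

variable {R K : Type*} [CommRing R] [Field K] [Algebra R K]

/-! Let x lie in every R_P containing T; it suffices to show x ∈ T locally at each maximal M. The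
primes below M form a chain, so one u ∈ T already detects which R_P with P ≤ M contain x: otherwise
T ⊆ R_Q for a minimal prime Q ≤ M over the denominator ideal of x, yet x ∉ R_Q. Now R[u] is an
intersection of localizations, and finiteness of the maximal spectrum lets that intersection commute
with localizing at M, so s • x ∈ R[u] ⊆ T for some s ∉ M. -/

/-- The ideal of all `s : R` that multiply `x : K` into the overring `T`. -/
def denominatorIdeal (T : Subalgebra R K) (x : K) : Ideal R :=
  T.toSubmodule.comap (LinearMap.toSpanSingleton R K x)

theorem mem_denominatorIdeal {T : Subalgebra R K} {x : K} {s : R} :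
    s ∈ denominatorIdeal T x ↔ s • x ∈ T := by
  simp [denominatorIdeal]

/-- An element lies in an overring as soon as it does so locally at every maximal ideal. -/
theorem mem_of_forall_maximal_exists_smul_mem {T : Subalgebra R K} {x : K}
    (h : ∀ M : Ideal R, M.IsMaximal → ∃ s ∉ M, s • x ∈ T) : x ∈ T := by
  have htop : denominatorIdeal T x = ⊤ := by
    by_contra hne
    obtain ⟨M, hM, hle⟩ := Ideal.exists_le_maximal _ hne
    obtain ⟨s, hs, hsx⟩ := h M hM
    exact hs (hle (mem_denominatorIdeal.2 hsx))
  simpa using mem_denominatorIdeal.1 (htop ▸ Submodule.mem_top : (1 : R) ∈ denominatorIdeal T x)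

variable [IsDomain R] [IsFractionRing R K]

theorem mem_localizationAt_iff {P : PrimeSpectrum R} {x : K} :
    x ∈ localizationAt R K P ↔ ¬ denominatorIdeal ⊥ x ≤ P.asIdeal := by
  have hfrac : x ∈ localizationAt R K P ↔
      ∃ (a s : R) (_ : s ∈ P.asIdeal.primeCompl), x = algebraMap R K a * (algebraMap R K s)⁻¹ :=
    Iff.rfl
  have hdiv {a s : R} (hs : s ∉ P.asIdeal) :
      x = algebraMap R K a * (algebraMap R K s)⁻¹ ↔ algebraMap R K a = s • x := by
    have hs0 : algebraMap R K s ≠ 0 := (FaithfulSMul.algebraMap_eq_zero_iff R K).not.2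
      fun h ↦ hs (h ▸ P.asIdeal.zero_mem)
    rw [eq_mul_inv_iff_mul_eq₀ hs0, Algebra.smul_def, mul_comm, eq_comm]
  rw [hfrac, SetLike.not_le_iff_exists]
  simp only [mem_denominatorIdeal, Algebra.mem_bot, Set.mem_range]
  constructor
  · rintro ⟨a, s, hs, h⟩
    exact ⟨s, ⟨a, (hdiv hs).1 h⟩, hs⟩
  · rintro ⟨s, ⟨a, h⟩, hs⟩
    exact ⟨a, s, hs, (hdiv hs).2 h⟩

theorem localizationAt_anti {P Q : PrimeSpectrum R} (h : P ≤ Q) :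
    localizationAt R K Q ≤ localizationAt R K P := fun _ hx ↦
  mem_localizationAt_iff.2 fun hP ↦ mem_localizationAt_iff.1 hx (hP.trans h)

end DenominatorIdeal

section Treed

variable {R K : Type*} [CommRing R] [IsDomain R] [Field K] [Algebra R K] [IsFractionRing R K]

/-- If `y` lies in `R_Q` for every prime `Q` below both `M` and `N`, then `y` lies in the
localization of `R_N` at the complement of `M`: some `s ∉ M` satisfies `s • y ∈ R_N`. -/
theorem exists_smul_mem_localizationAt {M N : PrimeSpectrum R} {y : K}
    (h : ∀ Q ≤ M, Q ≤ N → y ∈ localizationAt R K Q) :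
    ∃ s ∉ M.asIdeal, s • y ∈ localizationAt R K N := by
  -- A prime missing the products of elements outside M and outside N lies below both.
  have hdisj : ¬ Disjoint (denominatorIdeal (⊥ : Subalgebra R K) y : Set R)
      ((M.asIdeal.primeCompl ⊔ N.asIdeal.primeCompl : Submonoid R) : Set R) := by
    intro hd
    obtain ⟨Q, hQ, hle, hQd⟩ := Ideal.exists_le_prime_disjoint _ _ hd
    have below : ∀ N' : PrimeSpectrum R, N'.asIdeal.primeCompl ≤
        M.asIdeal.primeCompl ⊔ N.asIdeal.primeCompl → (⟨Q, hQ⟩ : PrimeSpectrum R) ≤ N' :=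
      fun N' hN' q hq ↦ by_contra fun hqN ↦ Set.disjoint_left.1 hQd hq (hN' hqN)
    exact mem_localizationAt_iff.1 (h ⟨Q, hQ⟩ (below M le_sup_left) (below N le_sup_right)) hle
  obtain ⟨b, hb, hbW⟩ := Set.not_disjoint_iff.1 hdisj
  obtain ⟨s, hs, t, ht, rfl⟩ := Submonoid.mem_sup.1 hbW
  refine ⟨s, hs, mem_localizationAt_iff.2 fun hle ↦ ht (hle (mem_denominatorIdeal.2 ?_))⟩
  rw [smul_smul, mul_comm]
  exact mem_denominatorIdeal.1 hb

/-- Over a semilocal domain with treed spectrum, if `R[u]` is an intersection of localizations of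
`R`, then so is its localization at any prime `M`. -/
theorem exists_smul_mem_adjoin_singleton (hsemi : IsSemilocal R) (htreed : HasTreedSpectrum R)
    {u y : K} (hu : IsIntersectionOfLocalizations R K (Algebra.adjoin R {u}))
    {M : PrimeSpectrum R}
    (hy : ∀ P ≤ M, u ∈ localizationAt R K P → y ∈ localizationAt R K P) :
    ∃ s ∉ M.asIdeal, s • y ∈ Algebra.adjoin R {u} := by
  obtain ⟨S, hS⟩ := hu
  have huS : ∀ P ∈ S, u ∈ localizationAt R K P := by
    have hmem : u ∈ ⨅ P ∈ S, localizationAt R K P := hS ▸ Algebra.self_mem_adjoin_singleton R u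
    simpa only [Algebra.mem_iInf] using hmem
  have key : ∀ N : MaximalSpectrum R, ∃ s ∉ M.asIdeal,
      ∀ P ∈ S, P ≤ N.toPrimeSpectrum → s • y ∈ localizationAt R K P := by
    intro N
    -- If some P₀ ∈ S below N is not below M, the chain below N puts every Q ≤ M, N under P₀, so u ∈
    -- R_Q.
    by_cases hall : ∀ P ∈ S, P ≤ N.toPrimeSpectrum → P ≤ M
    · exact ⟨1, M.asIdeal.one_notMem, fun P hP hPN ↦ by
        simpa using hy P (hall P hP hPN) (huS P hP)⟩
    · push Not at hall
      obtain ⟨P₀, hP₀, hP₀N, hP₀M⟩ := hall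
      obtain ⟨s, hs, hsy⟩ := exists_smul_mem_localizationAt (K := K) (M := M)
        (N := N.toPrimeSpectrum) (y := y) fun Q hQM hQN ↦ hy Q hQM <| by
          have hQP : Q ≤ P₀ := ((htreed N.toPrimeSpectrum).total hQN hP₀N).resolve_right
            fun h ↦ hP₀M (h.trans hQM)
          exact localizationAt_anti hQP (huS P₀ hP₀)
      exact ⟨s, hs, fun P _ hPN ↦ localizationAt_anti hPN hsy⟩
  choose s hsM hs using key
  have : Fintype (MaximalSpectrum R) := @Fintype.ofFinite _ hsemi
  classical
  refine ⟨∏ N, s N, fun h ↦ ?_, ?_⟩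
  · obtain ⟨N, -, hN⟩ := M.isPrime.prod_mem_iff.1 h
    exact hsM N hN
  · simp only [hS, Algebra.mem_iInf]
    intro P hP
    obtain ⟨N, hN, hPN⟩ := Ideal.exists_le_maximal P.asIdeal P.isPrime.ne_top
    rw [← Finset.prod_erase_mul _ _ (Finset.mem_univ (⟨N, hN⟩ : MaximalSpectrum R)), mul_smul]
    exact Subalgebra.smul_mem _ (hs ⟨N, hN⟩ P hP hPN) _

/-- If `x` lies in every localization of `R` containing the overring `T`, then, among the primes
below a fixed `M`, this is witnessed by a single element of `T`. -/
theorem exists_forall_mem_localizationAt_of_mem (htreed : HasTreedSpectrum R) {T : Subalgebra R K}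
    {x : K} (hx : ∀ P, T ≤ localizationAt R K P → x ∈ localizationAt R K P)
    (M : PrimeSpectrum R) :
    ∃ u ∈ T, ∀ P ≤ M, u ∈ localizationAt R K P → x ∈ localizationAt R K P := by
  by_contra! hno
  have hno' : ∀ u ∈ T, ∃ P ≤ M, u ∈ localizationAt R K P ∧
      denominatorIdeal ⊥ x ≤ P.asIdeal := fun u hu ↦ by
    obtain ⟨P, hPM, huP, hxP⟩ := hno u hu
    exact ⟨P, hPM, huP, not_not.1 (mem_localizationAt_iff.not.1 hxP)⟩
  -- The element 0 only serves to produce a prime below M over the denominator ideal.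
  obtain ⟨P₀, hP₀M, -, hle⟩ := hno' 0 T.zero_mem
  obtain ⟨Q, hQ, hQP₀⟩ := Ideal.exists_minimalPrimes_le hle
  let Q' : PrimeSpectrum R := ⟨Q, hQ.1.1⟩
  have hQM : Q' ≤ M := le_trans (b := P₀) hQP₀ hP₀M
  refine mem_localizationAt_iff.1 (hx Q' fun u hu ↦ ?_) hQ.1.2
  obtain ⟨P, hPM, huP, hxP⟩ := hno' u hu
  -- Comparable primes: minimality of Q excludes P strictly below it.
  have hQP : Q' ≤ P := ((htreed M).total hQM hPM).elim id fun h ↦ hQ.2 ⟨P.isPrime, hxP⟩ h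
  exact localizationAt_anti hQP huP

end Treed

theorem theorem2p17 (R K : Type*) [CommRing R] [IsDomain R] [Field K] [Algebra R K]
    [IsFractionRing R K] (hsemi : IsSemilocal R) (htreed : HasTreedSpectrum R)
    (hsQQR : IsSQQRDomain R K) : IsQQRDomain R K := by
  intro T
  refine ⟨{P | T ≤ localizationAt R K P}, le_antisymm (le_iInf₂ fun _ hP ↦ hP) fun x hx ↦ ?_⟩
  simp only [Algebra.mem_iInf, Set.mem_ofPred_eq] at hx
  refine mem_of_forall_maximal_exists_smul_mem fun M hM ↦ ?_
  obtain ⟨u, huT, hu⟩ := exists_forall_mem_localizationAt_of_mem htreed hx ⟨M, hM.isPrime⟩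
  obtain ⟨s, hs, hsx⟩ := exists_smul_mem_adjoin_singleton hsemi htreed (hsQQR u) hu
  exact ⟨s, hs, Algebra.adjoin_le (Set.singleton_subset_iff.2 huT) hsx⟩
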